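/- Let $n\ge 2$, let $e_1,\dots,e_n$ be the standard basis of Euclidean space $\mathbb R^n$, and take the root system of type $\mathsf B_n$, consisting of the vectors $\pm e_j$ and $\pm e_j\pm e_k$ ($j\ne k$), with simple roots $\alpha_j=e_j-e_{j+1}$ ($1\le j<n$), $\alpha_n=e_n$, and highest root $\theta=\alpha_1+2\sum_{j=2}^n\alpha_j=e_1+e_2=\theta^\vee$. Let $W_0$ be its finite Weyl group, and let $P=\{v\in\mathbb R^n : (\alpha,v)\in\mathbb Z\text{ for all roots }\alpha\}$, the lattice of coweights. Let $\widetilde W=W_0\ltimes P$ be the extended affine Weyl group of type $\mathsf B_n^{(1)}$, acting on $\mathbb R^n$ by affine transformations, where $P$ acts by translations $t_v$. For $1\le i\le n$ let $\omega_i\in\widetilde W$ be the translation by the $i$-th fundamental coweight $e_1+\cdots+e_i$ (the vector dual to $\alpha_i$ with respect to the basis $\alpha_1,\dots,\alpha_n$). Let $s_j$ be the reflection in $\alpha_j$ for $1\le j\le n$, let $s_0=t_{\theta^\vee}r_\theta$, where $r_\theta$ is the reflection in $\theta$, and put $[k,l]=s_ks_{k+1}\cdots s_l$ for $1\le k\le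 l\le n$. Let $\Lambda\subset\widetilde W$ be the subgroup of the elements that permute the simple affine roots $\alpha_0=1-\theta,\alpha_1,\dots,\alpha_n$ (regarded as affine functions on $\mathbb R^n$), and let $\pi_1\in\Lambda$ be the element $x\mapsto(1-x_1,x_2,\dots,x_n)$, which interchanges $\alpha_0$ and $\alpha_1$ and fixes $\alpha_2,\dots,\alpha_n$. The length $\ell(w)$ of $w\in\widetilde W$ is the least $r$ for which $w=\lambda s_{j_1}\cdots s_{j_r}$ with $\lambda\in\Lambda$ and $j_1,\dots,j_r\in\{0,\dots,n\}$, and such an expression with $r=\ell(w)$ is called reduced. Let $1\le i\le n$. If $i$ is odd, then $$\omega_i=\pi_1\,[1,n]\,\big(s_0[2,n][1,n]\big)^{\frac{i-1}{2}}\,[n-i,n-1]\cdots[2,i+1]\,[1,i].$$ If $i$ is even, then $$\omega_i=\big(s_0[2,n][1,n]\big)^{\frac{i}{2}}\,[n-i,n-1]\cdots[2,i+1]\,[1,i].$$ Here $[n-i,n-1]\cdots[1,i]$ is the product of the elements $[m,m+i-1]$ for $m=n-i,n-i-1,\dots,1$, in this order; it is empty if $i=n$. These expressions are reduced, with $i(2n-i)$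 simple reflections each, so that $\ell(\omega_i)=i(2n-i)$. -/

import Mathlib

namespace AffineB

noncomputable section

/-- The Euclidean space `ℝⁿ`. -/
abbrev V (n : ℕ) : Type := EuclideanSpace ℝ (Fin n)

/-- The group of invertible affine transformations of `ℝⁿ`; the product is composition,
`(g * h) x = g (h x)`. -/
abbrev Aff (n : ℕ) : Type := V n ≃ᵃ[ℝ] V n

/-- The standard basis vector `e_j` of `ℝⁿ`, numbered from `1` (so `1 ≤ j ≤ n`). -/
def e (n j : ℕ) : V n := WithLp.toLp 2 fun c : Fin n => if (c : ℕ) + 1 = j then 1 else 0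

/-- The root system of type `B_n`: the vectors `± e_j`, and `± e_j ± e_k` for `j ≠ k`. -/
def roots (n : ℕ) : Set (V n) :=
  {v | (∃ j ∈ Finset.Icc 1 n, v = e n j ∨ v = -e n j) ∨
    ∃ j ∈ Finset.Icc 1 n, ∃ k ∈ Finset.Icc 1 n, j ≠ k ∧
      (v = e n j + e n k ∨ v = e n j - e n k ∨ v = -e n j - e n k)}

/-- The simple roots `α_j = e_j - e_{j+1}` for `1 ≤ j < n`, and `α_n = e_n`. -/
def simpleRoot (n j : ℕ) : V n := if j = n then e n n else e n j - e n (j + 1)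

/-- The highest root `θ = e_1 + e_2`. It is long, with `(θ, θ) = 2`, so it equals its coroot. -/
def theta (n : ℕ) : V n := e n 1 + e n 2

/-- The orthogonal reflection in the hyperplane perpendicular to `α`. -/
def refl {n : ℕ} (α : V n) : Aff n := (ℝ ∙ α)ᗮ.reflection.toLinearEquiv.toAffineEquiv

/-- The translation by `v`. -/
def trans {n : ℕ} (v : V n) : Aff n := AffineEquiv.constVAdd ℝ (V n) v

/-- The finite Weyl group `W₀` of type `B_n`. -/
def weylGroup (n : ℕ) : Subgroup (Aff n) := Subgroup.closure (refl '' roots n)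

/-- The lattice `P` of coweights of type `B_n`, that is, the vectors which pair integrally with
every root. -/
def coweightLattice (n : ℕ) : Set (V n) :=
  {v | ∀ α ∈ roots n, ∃ m : ℤ, inner ℝ α v = (m : ℝ)}

/-- The extended affine Weyl group `W₀ ⋉ P` of type `B_n^(1)`, as a group of affine
transformations of `ℝⁿ`. -/
def extAffineWeyl (n : ℕ) : Subgroup (Aff n) :=
  weylGroup n ⊔ Subgroup.closure (trans '' coweightLattice n)

/-- The generators: `s_0 = t_θ r_θ`, and `s_j` is the reflection in `α_j` for `1 ≤ j ≤ n`. -/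
def s (n : ℕ) (j : Fin (n + 1)) : Aff n :=
  if j = 0 then trans (theta n) * refl (theta n) else refl (simpleRoot n j)

/-- The simple affine roots, as affine functions on `ℝⁿ`: `α_0 = 1 - θ` (where `1` stands for `δ`),
and `α_1, …, α_n`. -/
def affineSimpleRoot (n : ℕ) (j : Fin (n + 1)) (x : V n) : ℝ :=
  if j = 0 then 1 - inner ℝ (theta n) x else inner ℝ (simpleRoot n j) x

/-- The group `Λ` of those elements of the extended affine Weyl group which permute the simple
affine roots (so act as automorphisms of the affine Dynkin diagram). -/
def diagramGroup (n : ℕ) : Subgroup (Aff n) where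
  carrier := {w | w ∈ extAffineWeyl n ∧ ∃ σ : Equiv.Perm (Fin (n + 1)),
    ∀ j x, affineSimpleRoot n (σ j) (w x) = affineSimpleRoot n j x}
  one_mem' := ⟨one_mem _, 1, fun _ _ => rfl⟩
  mul_mem' := by
    rintro v w ⟨hv, σ, hσ⟩ ⟨hw, τ, hτ⟩
    refine ⟨mul_mem hv hw, σ * τ, fun j x => ?_⟩
    rw [Equiv.Perm.mul_apply, AffineEquiv.coe_mul, Function.comp_apply, hσ, hτ]
  inv_mem' := by
    rintro w ⟨hw, σ, hσ⟩
    refine ⟨inv_mem hw, σ⁻¹, fun j x => ?_⟩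
    have h := hσ (σ⁻¹ j) (w⁻¹ x)
    have h₁ : σ (σ⁻¹ j) = j := Equiv.apply_symm_apply σ j
    have h₂ : w (w⁻¹ x) = x := AffineEquiv.apply_symm_apply w x
    rw [h₁, h₂] at h
    exact h.symm

/-- The diagram automorphism `π_1`, realised as `x ↦ (1 - x_1, x_2, …, x_n)`. -/
def piOne (n : ℕ) : Aff n := trans (e n 1) * refl (e n 1)

/-- The `i`-th fundamental coweight `e_1 + ⋯ + e_i` of type `B_n`, dual to the simple roots. -/
def fundCoweight (n i : ℕ) : V n := ∑ j ∈ Finset.Icc 1 i, e n j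

/-- The element `ω_i` of the extended affine Weyl group: the translation by the `i`-th fundamental
coweight. -/
def omega (n i : ℕ) : Aff n := trans (fundCoweight n i)

/-- The product `s_{i_1} ⋯ s_{i_r}` of a word in the generators. -/
def wordProd (n : ℕ) (L : List (Fin (n + 1))) : Aff n := (L.map (s n)).prod

/-- The number `r` of simple reflections in a shortest expression `λ s_{i_1} ⋯ s_{i_r}` of `w`
with `λ ∈ Λ`. -/
def length (n : ℕ) (w : Aff n) : ℕ :=
  sInf {r | ∃ l ∈ diagramGroup n, ∃ L : List (Fin (n + 1)), L.length = r ∧ w = l * wordProd n L}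

/-- `l s_{i_1} ⋯ s_{i_r}`, where `L = (i_1, …, i_r)`, is a reduced expression of `w`. -/
def IsReducedExpression (n : ℕ) (w l : Aff n) (L : List (Fin (n + 1))) : Prop :=
  l ∈ diagramGroup n ∧ w = l * wordProd n L ∧ L.length = length n w

/-- The word `[k,l] = (k, k+1, …, l)`. -/
def seg (n k l : ℕ) : List (Fin (n + 1)) :=
  (List.finRange (n + 1)).filter fun j => k ≤ (j : ℕ) ∧ (j : ℕ) ≤ l

/-- The word `s_0 [2,n] [1,n]`. -/
def block (n : ℕ) : List (Fin (n + 1)) := 0 :: (seg n 2 n ++ seg n 1 n)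

/-- The word `[n-i,n-1] [n-i-1,n-2] ⋯ [2,i+1] [1,i]`, which is empty for `i = n`. -/
def tail (n i : ℕ) : List (Fin (n + 1)) :=
  (List.range (n - i)).flatMap fun t => seg n (n - i - t) (n - 1 - t)

/-- The word `[1,n] (s_0 [2,n] [1,n])^((i-1)/2) [n-i,n-1] ⋯ [1,i]`. -/
def oddWord (n i : ℕ) : List (Fin (n + 1)) :=
  seg n 1 n ++ (List.replicate ((i - 1) / 2) (block n)).flatten ++ tail n i

/-- The word `(s_0 [2,n] [1,n])^(i/2) [n-i,n-1] ⋯ [1,i]`. -/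
def evenWord (n i : ℕ) : List (Fin (n + 1)) :=
  (List.replicate (i / 2) (block n)).flatten ++ tail n i

end

/-! ### The objects above are what they are called -/

theorem trans_apply {n : ℕ} (v x : V n) : trans v x = v + x := rfl

theorem refl_apply {n : ℕ} (α x : V n) :
    refl α x = x - (2 * inner ℝ α x / ‖α‖ ^ 2) • α := by
  change (ℝ ∙ α)ᗮ.reflection x = _
  rw [Submodule.reflection_orthogonal_apply, Submodule.reflection_singleton_apply]
  simp only [RCLike.ofReal_real_eq_id, id_eq, neg_sub]
  rw [mul_div_assoc, mul_smul, ← Nat.cast_smul_eq_nsmul ℝ 2]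
  norm_num

theorem inner_e (n j k : ℕ) (hj : j ∈ Finset.Icc 1 n) :
    inner ℝ (e n j) (e n k) = if j = k then (1 : ℝ) else 0 := by
  rw [Finset.mem_Icc] at hj
  have h : ∀ c : Fin n, ((c : ℕ) + 1 = j ↔ c = ⟨j - 1, by omega⟩) := by
    intro c
    rw [Fin.ext_iff]
    constructor <;> intro h <;> simp only at * <;> omega
  simp only [e, PiLp.inner_apply, h]
  simp
  congr 1
  apply propext
  omega

theorem norm_e (n j : ℕ) (hj : j ∈ Finset.Icc 1 n) : ‖e n j‖ ^ 2 = 1 := by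
  rw [← real_inner_self_eq_norm_sq, inner_e n j j hj, if_pos rfl]

theorem simpleRoot_mem (n j : ℕ) (hj : j ∈ Finset.Icc 1 n) : simpleRoot n j ∈ roots n := by
  unfold simpleRoot
  rw [Finset.mem_Icc] at hj
  split_ifs with h
  · exact Or.inl ⟨n, Finset.mem_Icc.2 (by omega), Or.inl rfl⟩
  · exact Or.inr ⟨j, Finset.mem_Icc.2 (by omega), j + 1, Finset.mem_Icc.2 (by omega), by omega,
      Or.inr (Or.inl rfl)⟩

theorem theta_mem (n : ℕ) (hn : 2 ≤ n) : theta n ∈ roots n :=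
  Or.inr ⟨1, Finset.mem_Icc.2 (by omega), 2, Finset.mem_Icc.2 (by omega), by omega, Or.inl rfl⟩

/-- `θ = α_1 + 2 (α_2 + ⋯ + α_n)`. -/
theorem theta_eq (n : ℕ) (hn : 2 ≤ n) :
    theta n = simpleRoot n 1 + (2 : ℝ) • ∑ j ∈ Finset.Icc 2 n, simpleRoot n j := by
  have key : ∀ d k : ℕ, k + d = n → ∑ j ∈ Finset.Icc k n, simpleRoot n j = e n k := by
    intro d
    induction d with
    | zero => intro k hk; obtain rfl : k = n := hk; simp [simpleRoot]
    | succ d ih =>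
      intro k hk
      rw [← Finset.add_sum_Ioc_eq_sum_Icc (by omega : k ≤ n), ← Finset.Icc_succ_left_eq_Ioc]
      have := ih (k + 1) (by omega)
      simp only [Order.succ_eq_add_one]
      rw [this, simpleRoot, if_neg (by omega)]
      abel
  rw [key (n - 2) 2 (by omega), simpleRoot, if_neg (by omega), theta, two_smul]
  abel

theorem inner_e_fundCoweight (n i j : ℕ) (hj : j ∈ Finset.Icc 1 n) :
    inner ℝ (e n j) (fundCoweight n i) = if j ≤ i then (1 : ℝ) else 0 := by
  rw [fundCoweight, inner_sum, Finset.sum_congr rfl fun k _ => inner_e n j k hj]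
  rw [Finset.mem_Icc] at hj
  simp [hj.1]

/-- The fundamental coweights are dual to the simple roots. -/
theorem inner_simpleRoot_fundCoweight (n i j : ℕ) (hi : i ∈ Finset.Icc 1 n)
    (hj : j ∈ Finset.Icc 1 n) :
    inner ℝ (simpleRoot n j) (fundCoweight n i) = if j = i then (1 : ℝ) else 0 := by
  have hj' := Finset.mem_Icc.1 hj
  have hi' := Finset.mem_Icc.1 hi
  unfold simpleRoot
  split_ifs with h h' h'
  · rw [inner_e_fundCoweight n i n (h ▸ hj), if_pos (by omega)]
  · rw [inner_e_fundCoweight n i n (h ▸ hj), if_neg (by omega)]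
  · rw [inner_sub_left, inner_e_fundCoweight n i j hj,
      inner_e_fundCoweight n i (j + 1) (Finset.mem_Icc.2 (by omega)),
      if_pos (by omega), if_neg (by omega), sub_zero]
  · rw [inner_sub_left, inner_e_fundCoweight n i j hj,
      inner_e_fundCoweight n i (j + 1) (Finset.mem_Icc.2 (by omega))]
    by_cases h2 : j ≤ i
    · rw [if_pos h2, if_pos (by omega), sub_self]
    · rw [if_neg h2, if_neg (by omega), sub_self]

theorem fundCoweight_mem (n i : ℕ) : fundCoweight n i ∈ coweightLattice n := by
  have h : ∀ j ∈ Finset.Icc 1 n, ∃ m : ℤ, inner ℝ (e n j) (fundCoweight n i) = (m : ℝ) := by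
    intro j hj
    exact ⟨if j ≤ i then 1 else 0, by rw [inner_e_fundCoweight n i j hj]; split_ifs <;> simp⟩
  rintro α (⟨j, hj, rfl | rfl⟩ | ⟨j, hj, k, hk, -, rfl | rfl | rfl⟩)
  · exact h j hj
  · obtain ⟨m, hm⟩ := h j hj
    exact ⟨-m, by rw [inner_neg_left, hm]; push_cast; rfl⟩
  all_goals
    obtain ⟨m, hm⟩ := h j hj
    obtain ⟨p, hp⟩ := h k hk
  · exact ⟨m + p, by rw [inner_add_left, hm, hp]; push_cast; rfl⟩
  · exact ⟨m - p, by rw [inner_sub_left, hm, hp]; push_cast; rfl⟩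
  · exact ⟨-m - p, by rw [inner_sub_left, inner_neg_left, hm, hp]; push_cast; rfl⟩

theorem refl_mem {n : ℕ} {α : V n} (h : α ∈ roots n) : refl α ∈ extAffineWeyl n :=
  Subgroup.mem_sup_left (Subgroup.subset_closure ⟨α, h, rfl⟩)

theorem trans_mem {n : ℕ} {v : V n} (h : v ∈ coweightLattice n) : trans v ∈ extAffineWeyl n :=
  Subgroup.mem_sup_right (Subgroup.subset_closure ⟨v, h, rfl⟩)

theorem omega_mem (n i : ℕ) : omega n i ∈ extAffineWeyl n := trans_mem (fundCoweight_mem n i)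

theorem theta_eq_fundCoweight (n : ℕ) : theta n = fundCoweight n 2 := by
  simp [theta, fundCoweight, Finset.sum_Icc_succ_top]

theorem e_one_eq_fundCoweight (n : ℕ) : e n 1 = fundCoweight n 1 := by
  simp [fundCoweight]

theorem s_mem (n : ℕ) (hn : 2 ≤ n) (j : Fin (n + 1)) : s n j ∈ extAffineWeyl n := by
  unfold s
  split_ifs with h
  · refine mul_mem ?_ (refl_mem (theta_mem n hn))
    rw [theta_eq_fundCoweight]
    exact omega_mem n 2
  · have : (j : ℕ) ≠ 0 := fun h' => h (Fin.ext h')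
    exact refl_mem (simpleRoot_mem n j (Finset.mem_Icc.2 ⟨by omega, by omega⟩))

/-- `π_1` interchanges `α_0` and `α_1`, and fixes the other simple affine roots. -/
theorem affineSimpleRoot_piOne (n : ℕ) (hn : 2 ≤ n) (j : Fin (n + 1)) (x : V n) :
    affineSimpleRoot n (Equiv.swap 0 ⟨1, by omega⟩ j) (piOne n x) = affineSimpleRoot n j x := by
  have h1 : (1 : ℕ) ∈ Finset.Icc 1 n := Finset.mem_Icc.2 (by omega)
  have hp : piOne n x = e n 1 + (x - (2 * inner ℝ (e n 1) x) • e n 1) := by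
    rw [piOne, AffineEquiv.coe_mul, Function.comp_apply, trans_apply, refl_apply, norm_e n 1 h1,
      div_one]
  have he : ∀ k ∈ Finset.Icc 1 n, inner ℝ (e n k) (piOne n x) =
      if k = 1 then 1 - inner ℝ (e n 1) x else inner ℝ (e n k) x := by
    intro k hk
    rw [hp, inner_add_right, inner_sub_right, inner_smul_right, inner_e n k 1 hk]
    split_ifs with h
    · subst h; ring
    · ring
  have h1' := he 1 h1
  have h2' := he 2 (Finset.mem_Icc.2 (by omega))
  norm_num at h1' h2'
  have hne : (⟨1, by omega⟩ : Fin (n + 1)) ≠ 0 := by simp [Fin.ext_iff]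
  by_cases hj0 : j = 0
  · subst hj0
    rw [Equiv.swap_apply_left]
    simp only [affineSimpleRoot, if_neg hne, if_true, simpleRoot, theta]
    rw [if_neg (by omega), inner_sub_left, inner_add_left]
    norm_num
    rw [h1', h2']
    ring
  by_cases hj1 : j = ⟨1, by omega⟩
  · subst hj1
    rw [Equiv.swap_apply_right]
    simp only [affineSimpleRoot, if_neg hne, if_true, simpleRoot, theta]
    rw [if_neg (by omega), inner_sub_left, inner_add_left]
    norm_num
    rw [h1', h2']
    ring
  · rw [Equiv.swap_apply_of_ne_of_ne hj0 hj1]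
    have ha : (j : ℕ) ≠ 0 := fun h' => hj0 (Fin.ext h')
    have hb : (j : ℕ) ≠ 1 := fun h' => hj1 (Fin.ext h')
    simp only [affineSimpleRoot, if_neg hj0, simpleRoot]
    split_ifs with h
    · rw [he n (Finset.mem_Icc.2 (by omega)), if_neg (by omega)]
    · rw [inner_sub_left, inner_sub_left, he j (Finset.mem_Icc.2 (by omega)),
        he (j + 1) (Finset.mem_Icc.2 (by omega)), if_neg (by omega), if_neg (by omega)]

theorem piOne_mem (n : ℕ) (hn : 2 ≤ n) : piOne n ∈ diagramGroup n := by
  refine ⟨mul_mem ?_ (refl_mem ?_), _, affineSimpleRoot_piOne n hn⟩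
  · rw [e_one_eq_fundCoweight]
    exact omega_mem n 1
  · exact Or.inl ⟨1, Finset.mem_Icc.2 (by omega), Or.inl rfl⟩

end AffineB

/-!
Write `τ = π_1 [1,n]`; it is the affine map `x ↦ (1 + x_n, x_1, …, x_{n-1})`. In coordinates one
sees that `s_0 [2,n] [1,n] = τ ^ 2`, and that `[n-i,n-1] ⋯ [1,i]` permutes the coordinates so as to
bring the last `n - i` of them to the front; hence `ω_i = τ ^ i [n-i,n-1] ⋯ [1,i]` for every `i`,
and the two expressions in the theorem only differ in how `τ ^ i` is grouped.

For the lengths, the function `x, y ↦ ∑_α |⌊⟨α, x⟩⌋ - ⌊⟨α, y⟩⌋|`, summed over all roots, is a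
pseudometric invariant under the extended affine Weyl group. The group `Λ` preserves the fundamental
alcove, all of whose points have mutual distance `0`, and every `s_j` moves them by at most `2`, so
`λ s_{j_1} ⋯ s_{j_r}` moves them by at most `2r`. The translation `ω_i` moves every point by
`∑_α |⟨α, ϖ_i⟩| = 2 ⟨2ρ, ϖ_i⟩ = 2 i (2n - i)`, where `ϖ_i = e_1 + ⋯ + e_i` and `2ρ` is the sum of
the positive roots. So no expression of `ω_i` has fewer than `i (2n - i)` simple reflections.
-/

namespace AffineB

section Coordinates

variable {n : ℕ}

theorem eq_of_inner_e_eq {x y : V n}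
    (h : ∀ m ∈ Finset.Icc 1 n, inner ℝ (e n m) x = inner ℝ (e n m) y) : x = y := by
  have inner_e_succ (z : V n) (c : Fin n) : inner ℝ (e n (c + 1)) z = z c := by
    simp [e, PiLp.inner_apply, ← Fin.ext_iff]
  ext c
  rw [← inner_e_succ x, ← inner_e_succ y]
  exact h _ (Finset.mem_Icc.2 (by omega))

theorem norm_sq_simpleRoot {j : ℕ} (hj : j ∈ Finset.Icc 1 n) :
    ‖simpleRoot n j‖ ^ 2 = if j = n then 1 else 2 := by
  have hj' := Finset.mem_Icc.1 hj
  unfold simpleRoot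
  split_ifs with hjn
  · exact norm_e n n (hjn ▸ hj)
  · rw [norm_sub_sq_real, norm_e n j hj, norm_e n (j + 1) (Finset.mem_Icc.2 (by omega)),
      inner_e n j (j + 1) hj, if_neg (by omega)]
    norm_num

theorem norm_sq_theta (hn : 2 ≤ n) : ‖theta n‖ ^ 2 = 2 := by
  have h1 : 1 ∈ Finset.Icc 1 n := Finset.mem_Icc.2 (by omega)
  rw [theta, norm_add_sq_real, norm_e n 1 h1, norm_e n 2 (Finset.mem_Icc.2 (by omega)),
    inner_e n 1 2 h1, if_neg (by omega)]
  norm_num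

theorem sum_simpleRoot_Icc {k : ℕ} (hk : k ≤ n) :
    ∑ j ∈ Finset.Icc k n, simpleRoot n j = e n k := by
  induction hk using Nat.decreasingInduction with
  | self => simp [simpleRoot]
  | of_succ k hk ih =>
    rw [← Finset.add_sum_Ioc_eq_sum_Icc hk.le, ← Finset.Icc_succ_left_eq_Ioc,
      Order.succ_eq_add_one, ih, simpleRoot, if_neg hk.ne, sub_add_cancel]

theorem sum_inner_simpleRoot_smul_fundCoweight (x : V n) :
    ∑ k ∈ Finset.Icc 1 n, inner ℝ (simpleRoot n k) x • fundCoweight n k = x := by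
  refine eq_of_inner_e_eq fun m hm => ?_
  have hm' := Finset.mem_Icc.1 hm
  have hfilter : (Finset.Icc 1 n).filter (m ≤ ·) = Finset.Icc m n := by
    ext k
    simp only [Finset.mem_filter, Finset.mem_Icc]
    omega
  simp only [inner_sum, inner_smul_right, inner_e_fundCoweight n _ m hm, mul_ite, mul_one,
    mul_zero]
  rw [← Finset.sum_filter, hfilter, ← sum_inner, sum_simpleRoot_Icc hm'.2]

theorem inner_eq_sum_fundCoweight_mul_simpleRoot (v x : V n) :
    inner ℝ v x = ∑ k ∈ Finset.Icc 1 n,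
      inner ℝ v (fundCoweight n k) * inner ℝ (simpleRoot n k) x := by
  conv_lhs => rw [← sum_inner_simpleRoot_smul_fundCoweight x]
  simp only [inner_sum, inner_smul_right, mul_comm]

theorem fundCoweight_succ (k : ℕ) : fundCoweight n (k + 1) = fundCoweight n k + e n (k + 1) :=
  Finset.sum_Icc_succ_top (Nat.le_add_left 1 k) _

end Coordinates

section Reflections

variable {n : ℕ}

theorem refl_refl (α x : V n) : refl α (refl α x) = x :=
  Submodule.reflection_reflection _ x

theorem norm_refl (α x : V n) : ‖refl α x‖ = ‖x‖ :=
  (ℝ ∙ α)ᗮ.reflection.norm_map x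

theorem refl_self (α : V n) : refl α α = -α :=
  Submodule.reflection_orthogonalComplement_singleton_eq_neg α

theorem inner_refl_right (α x y : V n) : inner ℝ x (refl α y) = inner ℝ (refl α x) y := by
  conv_lhs => rw [← refl_refl α x]
  exact (ℝ ∙ α)ᗮ.reflection.inner_map_map (refl α x) y

theorem refl_eq_self {α x : V n} (h : inner ℝ α x = 0) : refl α x = x := by
  rw [refl_apply, h, mul_zero, zero_div, zero_smul, sub_zero]

end Reflections

section Roots

variable {n : ℕ}

/-- The coweight lattice as an additive subgroup, so that the closure lemmas for subgroups apply
to it. -/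
def coweightSubgroup (n : ℕ) : AddSubgroup (V n) where
  carrier := coweightLattice n
  zero_mem' α _ := ⟨0, by rw [inner_zero_right, Int.cast_zero]⟩
  add_mem' hv hw α hα := by
    obtain ⟨a, ha⟩ := hv α hα
    obtain ⟨b, hb⟩ := hw α hα
    exact ⟨a + b, by rw [inner_add_right, ha, hb, Int.cast_add]⟩
  neg_mem' hv α hα := by
    obtain ⟨a, ha⟩ := hv α hα
    exact ⟨-a, by rw [inner_neg_right, ha, Int.cast_neg]⟩

theorem e_mem_coweightSubgroup {k : ℕ} (hk : 1 ≤ k) : e n k ∈ coweightSubgroup n := by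
  obtain ⟨k, rfl⟩ := Nat.exists_eq_add_of_le' hk
  rw [← add_sub_cancel_left (fundCoweight n k) (e n (k + 1)), ← fundCoweight_succ]
  exact sub_mem (S := AddSubgroup (V n)) (fundCoweight_mem n (k + 1)) (fundCoweight_mem n k)

theorem mem_coweightSubgroup_of_mem_roots {α : V n} (hα : α ∈ roots n) :
    α ∈ coweightSubgroup n := by
  have he {j : ℕ} (hj : j ∈ Finset.Icc 1 n) : e n j ∈ coweightSubgroup n :=
    e_mem_coweightSubgroup (Finset.mem_Icc.1 hj).1
  rcases hα with ⟨j, hj, rfl | rfl⟩ | ⟨j, hj, k, hk, -, rfl | rfl | rfl⟩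
  · exact he hj
  · exact neg_mem (he hj)
  · exact add_mem (he hj) (he hk)
  · exact sub_mem (he hj) (he hk)
  · exact sub_mem (neg_mem (he hj)) (he hk)

theorem norm_sq_of_mem_roots {α : V n} (hα : α ∈ roots n) : ‖α‖ ^ 2 = 1 ∨ ‖α‖ ^ 2 = 2 := by
  rcases hα with ⟨j, hj, rfl | rfl⟩ | ⟨j, hj, k, hk, hjk, rfl | rfl | rfl⟩
  · exact .inl (norm_e n j hj)
  · exact .inl (by rw [norm_neg, norm_e n j hj])
  all_goals
    right
    simp only [norm_add_sq_real, norm_sub_sq_real, norm_neg, inner_neg_left, norm_e n j hj,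
      norm_e n k hk, inner_e n j k hj, if_neg hjk]
    norm_num

theorem exists_inner_e_eq_one_or_neg_one {v : V n} (hv : v ∈ coweightSubgroup n) (hv0 : v ≠ 0)
    (hnorm : ‖v‖ ^ 2 < 4) :
    ∃ j ∈ Finset.Icc 1 n, inner ℝ (e n j) v = 1 ∨ inner ℝ (e n j) v = -1 := by
  obtain ⟨j, hj, hvj⟩ : ∃ j ∈ Finset.Icc 1 n, inner ℝ (e n j) v ≠ 0 := by
    by_contra! h
    exact hv0 (eq_of_inner_e_eq fun m hm => by rw [h m hm, inner_zero_right])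
  obtain ⟨a, ha⟩ := hv _ (.inl ⟨j, hj, .inl rfl⟩)
  have ha_sq : (a : ℝ) ^ 2 < 4 := by
    have h := real_inner_mul_inner_self_le (e n j) v
    rw [real_inner_self_eq_norm_sq, real_inner_self_eq_norm_sq, norm_e n j hj, ha] at h
    linarith
  have ha0 : a ≠ 0 := by
    rintro rfl
    exact hvj (by rw [ha, Int.cast_zero])
  have ha_sq' : a ^ 2 < 4 := by exact_mod_cast ha_sq
  have ha_abs : a = 1 ∨ a = -1 := by
    have : a < 2 := by nlinarith
    have : -2 < a := by nlinarith
    omega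
  refine ⟨j, hj, ?_⟩
  rw [ha]
  exact_mod_cast ha_abs

theorem exists_sub_smul_e_norm_sq {v : V n} (hv : v ∈ coweightSubgroup n) (hv0 : v ≠ 0)
    (hnorm : ‖v‖ ^ 2 < 4) :
    ∃ j ∈ Finset.Icc 1 n, ∃ c : ℝ, (c = 1 ∨ c = -1) ∧ v - c • e n j ∈ coweightSubgroup n ∧
      inner ℝ (e n j) (v - c • e n j) = 0 ∧ ‖v - c • e n j‖ ^ 2 = ‖v‖ ^ 2 - 1 := by
  obtain ⟨j, hj, hvj⟩ := exists_inner_e_eq_one_or_neg_one hv hv0 hnorm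
  have he := e_mem_coweightSubgroup (n := n) (Finset.mem_Icc.1 hj).1
  refine ⟨j, hj, inner ℝ (e n j) v, hvj, ?_, ?_, ?_⟩
  · rcases hvj with h | h <;> rw [h]
    · rw [one_smul]
      exact sub_mem hv he
    · rw [neg_one_smul]
      exact sub_mem hv (neg_mem he)
  · rw [inner_sub_right, inner_smul_right, inner_e n j j hj, if_pos rfl, mul_one, sub_self]
  · rw [norm_sub_sq_real, inner_smul_right, norm_smul, mul_pow, norm_e n j hj,
      real_inner_comm (e n j) v]
    rcases hvj with h | h <;> simp only [h, norm_neg, norm_one] <;> ring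

theorem exists_eq_smul_e_of_norm_sq_eq_one {v : V n} (hv : v ∈ coweightSubgroup n)
    (hnorm : ‖v‖ ^ 2 = 1) :
    ∃ j ∈ Finset.Icc 1 n, ∃ c : ℝ, (c = 1 ∨ c = -1) ∧ v = c • e n j := by
  have hv0 : v ≠ 0 := by
    rintro rfl
    simp at hnorm
  obtain ⟨j, hj, c, hc, -, -, hsub⟩ := exists_sub_smul_e_norm_sq hv hv0 (by rw [hnorm]; norm_num)
  refine ⟨j, hj, c, hc, sub_eq_zero.1 ?_⟩
  rwa [hnorm, sub_self, sq_eq_zero_iff, norm_eq_zero] at hsub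

theorem mem_roots_iff {v : V n} :
    v ∈ roots n ↔ v ∈ coweightSubgroup n ∧ (‖v‖ ^ 2 = 1 ∨ ‖v‖ ^ 2 = 2) := by
  refine ⟨fun h => ⟨mem_coweightSubgroup_of_mem_roots h, norm_sq_of_mem_roots h⟩, ?_⟩
  rintro ⟨hv, hnorm | hnorm⟩
  · obtain ⟨j, hj, c, rfl | rfl, rfl⟩ := exists_eq_smul_e_of_norm_sq_eq_one hv hnorm
    · exact .inl ⟨j, hj, .inl (one_smul ..)⟩
    · exact .inl ⟨j, hj, .inr (neg_one_smul ..)⟩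
  · have hv0 : v ≠ 0 := by
      rintro rfl
      simp at hnorm
    obtain ⟨j, hj, c, hc, hmem, horth, hsub⟩ :=
      exists_sub_smul_e_norm_sq hv hv0 (by rw [hnorm]; norm_num)
    obtain ⟨k, hk, d, hd, hvk⟩ :=
      exists_eq_smul_e_of_norm_sq_eq_one hmem (by rw [hsub, hnorm]; norm_num)
    have hjk : j ≠ k := by
      rintro rfl
      rw [hvk, inner_smul_right, inner_e n j j hj, if_pos rfl, mul_one] at horth
      rcases hd with rfl | rfl <;> norm_num at horth
    rw [sub_eq_iff_eq_add'] at hvk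
    rcases hc with rfl | rfl <;> rcases hd with rfl | rfl <;>
      simp only [one_smul, neg_one_smul, ← sub_eq_add_neg, neg_add_eq_sub] at hvk
    · exact .inr ⟨j, hj, k, hk, hjk, .inl hvk⟩
    · exact .inr ⟨j, hj, k, hk, hjk, .inr (.inl hvk)⟩
    · exact .inr ⟨k, hk, j, hj, hjk.symm, .inr (.inl hvk)⟩
    · exact .inr ⟨j, hj, k, hk, hjk, .inr (.inr hvk)⟩

theorem neg_mem_roots {α : V n} (hα : α ∈ roots n) : -α ∈ roots n := by
  rw [mem_roots_iff] at hα ⊢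
  rw [norm_neg]
  exact ⟨neg_mem hα.1, hα.2⟩

theorem refl_mem_roots {α β : V n} (hα : α ∈ roots n) (hβ : β ∈ roots n) :
    refl α β ∈ roots n := by
  have ⟨hα_mem, hα_norm⟩ := mem_roots_iff.1 hα
  have ⟨hβ_mem, hβ_norm⟩ := mem_roots_iff.1 hβ
  rw [mem_roots_iff, norm_refl]
  refine ⟨?_, hβ_norm⟩
  obtain ⟨a, ha⟩ := hβ_mem α hα
  obtain ⟨c, hc⟩ : ∃ c : ℤ, 2 * inner ℝ α β / ‖α‖ ^ 2 = (c : ℝ) := by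
    rcases hα_norm with h | h <;> rw [h, ha]
    · exact ⟨2 * a, by push_cast; ring⟩
    · exact ⟨a, by ring⟩
  rw [refl_apply, hc, Int.cast_smul_eq_zsmul]
  exact sub_mem hβ_mem (zsmul_mem hα_mem c)

theorem finite_roots (n : ℕ) : (roots n).Finite := by
  refine ((Finset.Icc 1 n).finite_toSet.biUnion fun j _ =>
    (Finset.Icc 1 n).finite_toSet.biUnion fun k _ => Set.toFinite
      {e n j, -e n j, e n j + e n k, e n j - e n k, -e n j - e n k}).subset ?_
  intro v hv
  simp only [Set.mem_iUnion, Finset.mem_coe, Set.mem_insert_iff, Set.mem_singleton_iff]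
  rcases hv with ⟨j, hj, h⟩ | ⟨j, hj, k, hk, -, h⟩
  · exact ⟨j, hj, j, hj, by tauto⟩
  · exact ⟨j, hj, k, hk, by tauto⟩

end Roots

section PositiveRoots

variable {n : ℕ}

theorem eq_of_inner_fundCoweight_eq {v w : V n}
    (h : ∀ k ∈ Finset.Icc 1 n, inner ℝ v (fundCoweight n k) = inner ℝ w (fundCoweight n k)) :
    v = w := by
  refine ext_inner_right ℝ fun x => ?_
  rw [inner_eq_sum_fundCoweight_mul_simpleRoot v x, inner_eq_sum_fundCoweight_mul_simpleRoot w x]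
  exact Finset.sum_congr rfl fun k hk => by rw [h k hk]

/-- A vector is positive if its coordinates in the basis of simple roots are nonnegative; these
coordinates are its pairings with the fundamental coweights. -/
def IsPositive (α : V n) : Prop := ∀ k ∈ Finset.Icc 1 n, 0 ≤ inner ℝ α (fundCoweight n k)

theorem isPositive_simpleRoot {j : ℕ} (hj : j ∈ Finset.Icc 1 n) : IsPositive (simpleRoot n j) := by
  intro k hk
  rw [inner_simpleRoot_fundCoweight n k j hk hj]
  split_ifs <;> norm_num

theorem isPositive_or_isPositive_neg {α : V n} (hα : α ∈ roots n) :
    IsPositive α ∨ IsPositive (-α) := by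
  unfold IsPositive
  rcases hα with ⟨j, hj, rfl | rfl⟩ | ⟨j, hj, k, hk, hjk, rfl | rfl | rfl⟩ <;>
    simp only [neg_neg, neg_sub, inner_add_left, inner_sub_left, inner_neg_left,
      inner_e_fundCoweight n _ j hj]
  · exact .inl fun m _ => by split_ifs <;> norm_num
  · exact .inr fun m _ => by split_ifs <;> norm_num
  all_goals simp only [inner_e_fundCoweight n _ k hk]
  · exact .inl fun m _ => by split_ifs <;> norm_num
  · rcases hjk.lt_or_gt with h | h
    · exact .inl fun m _ => by split_ifs <;> first | omega | norm_num
    · exact .inr fun m _ => by split_ifs <;> first | omega | norm_num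
  · exact .inr fun m _ => by split_ifs <;> norm_num

theorem IsPositive.not_isPositive_neg {α : V n} (hα : α ∈ roots n) (hpos : IsPositive α) :
    ¬IsPositive (-α) := by
  intro hneg
  have hα0 : α = 0 := eq_of_inner_fundCoweight_eq fun k hk => by
    have h := hneg k hk
    rw [inner_neg_left] at h
    rw [inner_zero_left]
    exact le_antisymm (by linarith) (hpos k hk)
  have := norm_sq_of_mem_roots hα
  rw [hα0, norm_zero] at this
  norm_num at this

theorem inner_fundCoweight_le_theta (hn : 2 ≤ n) {α : V n} (hα : α ∈ roots n) {m : ℕ}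
    (hm : m ∈ Finset.Icc 1 n) :
    inner ℝ α (fundCoweight n m) ≤ inner ℝ (theta n) (fundCoweight n m) := by
  have hm' := Finset.mem_Icc.1 hm
  have htheta : inner ℝ (theta n) (fundCoweight n m) = 1 + if 2 ≤ m then (1 : ℝ) else 0 := by
    rw [theta, inner_add_left, inner_e_fundCoweight n m 1 (Finset.mem_Icc.2 (by omega)),
      inner_e_fundCoweight n m 2 (Finset.mem_Icc.2 (by omega)), if_pos hm'.1]
  rw [htheta]
  rcases hα with ⟨j, hj, rfl | rfl⟩ | ⟨j, hj, k, hk, hjk, rfl | rfl | rfl⟩ <;>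
    simp only [inner_add_left, inner_sub_left, inner_neg_left, inner_e_fundCoweight n _ j hj]
  · split_ifs <;> norm_num
  · split_ifs <;> norm_num
  all_goals
    rw [Finset.mem_Icc] at hj hk
    rw [inner_e_fundCoweight n _ k (Finset.mem_Icc.2 hk)]
    split_ifs <;> first | omega | norm_num

theorem eq_one_of_smul_mem_roots {α : V n} (hα : α ∈ roots n) {c : ℤ} (hc : 0 ≤ c)
    (hcα : (c : ℝ) • α ∈ roots n) : c = 1 := by
  have hnorm : ‖(c : ℝ) • α‖ ^ 2 = (c : ℝ) ^ 2 * ‖α‖ ^ 2 := by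
    rw [norm_smul, mul_pow, Real.norm_eq_abs, sq_abs]
  have hα_norm := norm_sq_of_mem_roots hα
  have hcα_norm := norm_sq_of_mem_roots hcα
  rw [hnorm] at hcα_norm
  have hc_pos : 0 < (c : ℝ) ^ 2 := by
    rcases hα_norm with h | h <;> rw [h] at hcα_norm <;>
      rcases hcα_norm with h' | h' <;> linarith
  have hc_lt : (c : ℝ) ^ 2 < 4 := by
    rcases hα_norm with h | h <;> rw [h] at hcα_norm <;>
      rcases hcα_norm with h' | h' <;> linarith
  have hc_pos' : 0 < c ^ 2 := by exact_mod_cast hc_pos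
  have hc_lt' : c ^ 2 < 4 := by exact_mod_cast hc_lt
  have : c < 2 := by nlinarith
  have : c ≠ 0 := by
    rintro rfl
    norm_num at hc_pos'
  omega

theorem IsPositive.refl_simpleRoot {α : V n} (hα : α ∈ roots n) (hpos : IsPositive α) {j : ℕ}
    (hj : j ∈ Finset.Icc 1 n) (hαj : α ≠ simpleRoot n j) :
    IsPositive (refl (simpleRoot n j) α) := by
  have hαj_mem := simpleRoot_mem n j hj
  by_contra hrefl
  have hneg := (isPositive_or_isPositive_neg (refl_mem_roots hαj_mem hα)).resolve_left hrefl
  have inner_eq_zero {k : ℕ} (hk : k ∈ Finset.Icc 1 n) (hkj : k ≠ j) :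
      inner ℝ α (fundCoweight n k) = 0 := by
    have hfix : refl (simpleRoot n j) (fundCoweight n k) = fundCoweight n k :=
      refl_eq_self (by rw [inner_simpleRoot_fundCoweight n k j hk hj, if_neg hkj.symm])
    have h := hneg k hk
    rw [inner_neg_left, ← inner_refl_right, hfix] at h
    exact le_antisymm (by linarith) (hpos k hk)
  obtain ⟨c, hc⟩ := fundCoweight_mem n j α hα
  have hα_eq : α = (c : ℝ) • simpleRoot n j := eq_of_inner_fundCoweight_eq fun k hk => by
    rw [inner_smul_left, inner_simpleRoot_fundCoweight n k j hk hj]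
    split_ifs with hjk
    · simp [← hjk, hc]
    · rw [inner_eq_zero hk (Ne.symm hjk), mul_zero]
  have hc0 : 0 ≤ c := by
    have := hpos j hj
    rw [hc] at this
    exact_mod_cast this
  have hc1 := eq_one_of_smul_mem_roots hαj_mem hc0 (hα_eq ▸ hα)
  rw [hc1, Int.cast_one, one_smul] at hα_eq
  exact hαj hα_eq

end PositiveRoots

section SumOfPositiveRoots

variable {n : ℕ}

/-- The roots of type `B_n`, as a finset to sum over. -/
noncomputable def rootFinset (n : ℕ) : Finset (V n) := (finite_roots n).toFinset

open Classical in
/-- The roots of type `B_n` that are positive with respect to the given simple roots. -/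
noncomputable def posRoots (n : ℕ) : Finset (V n) := (rootFinset n).filter IsPositive

theorem mem_rootFinset {α : V n} : α ∈ rootFinset n ↔ α ∈ roots n := Set.Finite.mem_toFinset _

theorem mem_posRoots {α : V n} : α ∈ posRoots n ↔ α ∈ roots n ∧ IsPositive α := by
  classical rw [posRoots, Finset.mem_filter, mem_rootFinset]

theorem sum_rootFinset_eq_two_mul_sum_posRoots {f : V n → ℝ} (hf : ∀ α, f (-α) = f α) :
    ∑ α ∈ rootFinset n, f α = 2 * ∑ α ∈ posRoots n, f α := by
  classical
  have hneg : ∑ α ∈ (rootFinset n).filter (¬IsPositive ·), f α = ∑ α ∈ posRoots n, f α := by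
    refine Finset.sum_nbij' (-·) (-·) (fun α hα => ?_) (fun α hα => ?_) (fun α _ => neg_neg α)
      (fun α _ => neg_neg α) fun α _ => (hf α).symm
    · rw [Finset.mem_filter, mem_rootFinset] at hα
      exact mem_posRoots.2
        ⟨neg_mem_roots hα.1, (isPositive_or_isPositive_neg hα.1).resolve_left hα.2⟩
    · rw [mem_posRoots] at hα
      rw [Finset.mem_filter, mem_rootFinset]
      exact ⟨neg_mem_roots hα.1, hα.2.not_isPositive_neg hα.1⟩
  rw [← Finset.sum_filter_add_sum_filter_not (rootFinset n) IsPositive, hneg, two_mul, posRoots]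

/-- The sum of the positive roots, usually denoted `2ρ`. -/
noncomputable def twoRho (n : ℕ) : V n := ∑ α ∈ posRoots n, α

theorem inner_simpleRoot_twoRho {j : ℕ} (hj : j ∈ Finset.Icc 1 n) :
    inner ℝ (simpleRoot n j) (twoRho n) = ‖simpleRoot n j‖ ^ 2 := by
  classical
  have hαj_mem := simpleRoot_mem n j hj
  have refl_mem_erase {α : V n} (hα : α ∈ (posRoots n).erase (simpleRoot n j)) :
      refl (simpleRoot n j) α ∈ (posRoots n).erase (simpleRoot n j) := by
    rw [Finset.mem_erase, mem_posRoots] at hα ⊢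
    obtain ⟨hne, hα_mem, hα_pos⟩ := hα
    refine ⟨fun h => ?_, refl_mem_roots hαj_mem hα_mem, hα_pos.refl_simpleRoot hα_mem hj hne⟩
    have hα_eq : α = -simpleRoot n j := by
      rw [← refl_refl (simpleRoot n j) α, h, refl_self]
    exact (isPositive_simpleRoot hj).not_isPositive_neg hαj_mem (hα_eq ▸ hα_pos)
  -- Reindexing by the reflection shows that the other positive roots sum to a vector orthogonal to
  -- the simple root.
  have hsum : ∑ α ∈ (posRoots n).erase (simpleRoot n j), inner ℝ (simpleRoot n j) α =
      ∑ α ∈ (posRoots n).erase (simpleRoot n j), -inner ℝ (simpleRoot n j) α :=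
    Finset.sum_nbij' (refl (simpleRoot n j)) (refl (simpleRoot n j))
      (fun _ => refl_mem_erase) (fun _ => refl_mem_erase)
      (fun α _ => refl_refl _ α) (fun α _ => refl_refl _ α)
      fun α _ => by rw [inner_refl_right, refl_self, inner_neg_left, neg_neg]
  rw [Finset.sum_neg_distrib] at hsum
  have hj_pos : simpleRoot n j ∈ posRoots n := mem_posRoots.2 ⟨hαj_mem, isPositive_simpleRoot hj⟩
  rw [twoRho, inner_sum, ← Finset.add_sum_erase _ _ hj_pos, real_inner_self_eq_norm_sq]
  linarith

theorem inner_e_twoRho {m : ℕ} (hm : 1 ≤ m) (hmn : m ≤ n) :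
    inner ℝ (e n m) (twoRho n) = 2 * (n - m : ℝ) + 1 := by
  induction hmn using Nat.decreasingInduction with
  | self =>
    have hn : n ∈ Finset.Icc 1 n := Finset.mem_Icc.2 ⟨hm, le_rfl⟩
    have h := inner_simpleRoot_twoRho hn
    rw [norm_sq_simpleRoot hn, if_pos rfl, simpleRoot, if_pos rfl] at h
    rw [h]
    ring
  | of_succ m hmn ih =>
    have hm' : m ∈ Finset.Icc 1 n := Finset.mem_Icc.2 ⟨hm, hmn.le⟩
    have h := inner_simpleRoot_twoRho hm'
    rw [norm_sq_simpleRoot hm', if_neg hmn.ne, simpleRoot, if_neg hmn.ne, inner_sub_left,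
      ih (Nat.le_add_left 1 m), Nat.cast_succ] at h
    linarith

theorem inner_fundCoweight_twoRho {i : ℕ} (hin : i ≤ n) :
    inner ℝ (fundCoweight n i) (twoRho n) = i * (2 * n - i : ℝ) := by
  induction i with
  | zero => rw [fundCoweight, Finset.Icc_eq_empty (by simp), Finset.sum_empty, inner_zero_left,
      Nat.cast_zero, zero_mul]
  | succ i ih =>
    rw [fundCoweight_succ, inner_add_left, ih (by omega), inner_e_twoRho (by omega) hin]
    push_cast
    ring

end SumOfPositiveRoots

section SeparationDistance

variable {n : ℕ}

/-- The separation distance, which counts the affine hyperplanes `⟨α, ·⟩ = k`, with `α` a root and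
`k` an integer, between two points. Every hyperplane occurs for `α` and for `-α`, so for points that
lie on none of them this is twice the number of separating hyperplanes. -/
noncomputable def sepDist (x y : V n) : ℤ :=
  ∑ α ∈ rootFinset n, |⌊(inner ℝ α x : ℝ)⌋ - ⌊(inner ℝ α y : ℝ)⌋|

theorem sepDist_triangle (x y z : V n) : sepDist x z ≤ sepDist x y + sepDist y z := by
  rw [sepDist, sepDist, sepDist, ← Finset.sum_add_distrib]
  exact Finset.sum_le_sum fun α _ => abs_sub_le _ _ _

theorem sepDist_refl_apply {β : V n} (hβ : β ∈ roots n) (x y : V n) :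
    sepDist (refl β x) (refl β y) = sepDist x y := by
  have refl_mem_rootFinset {α : V n} (hα : α ∈ rootFinset n) : refl β α ∈ rootFinset n :=
    mem_rootFinset.2 (refl_mem_roots hβ (mem_rootFinset.1 hα))
  exact Finset.sum_nbij' (refl β) (refl β) (fun _ => refl_mem_rootFinset)
    (fun _ => refl_mem_rootFinset) (fun α _ => refl_refl β α) (fun α _ => refl_refl β α)
    fun α _ => by rw [inner_refl_right, inner_refl_right]

theorem sepDist_trans_apply {v : V n} (hv : v ∈ coweightLattice n) (x y : V n) :
    sepDist (trans v x) (trans v y) = sepDist x y := by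
  refine Finset.sum_congr rfl fun α hα => ?_
  obtain ⟨a, ha⟩ := hv α (mem_rootFinset.1 hα)
  rw [trans_apply, trans_apply, inner_add_right, inner_add_right, ha, Int.floor_intCast_add,
    Int.floor_intCast_add, add_sub_add_left_eq_sub]

theorem sepDist_apply_of_mem_extAffineWeyl {w : Aff n} (hw : w ∈ extAffineWeyl n) (x y : V n) :
    sepDist (w x) (w y) = sepDist x y := by
  rw [extAffineWeyl, weylGroup, ← Subgroup.closure_union] at hw
  induction hw using Subgroup.closure_induction generalizing x y with
  | mem w hw =>
    rcases hw with ⟨β, hβ, rfl⟩ | ⟨v, hv, rfl⟩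
    · exact sepDist_refl_apply hβ x y
    · exact sepDist_trans_apply hv x y
  | one => rfl
  | mul u w _ _ hu hw => exact (hu (w x) (w y)).trans (hw x y)
  | inv w _ hw =>
    rw [← hw]
    exact congrArg₂ sepDist (w.apply_symm_apply x) (w.apply_symm_apply y)

theorem sepDist_trans_apply_right {v : V n} (hv : v ∈ coweightLattice n) (x : V n) :
    (sepDist x (trans v x) : ℝ) = ∑ α ∈ rootFinset n, |inner ℝ α v| := by
  rw [sepDist, Int.cast_sum]
  refine Finset.sum_congr rfl fun α hα => ?_
  obtain ⟨a, ha⟩ := hv α (mem_rootFinset.1 hα)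
  rw [trans_apply, inner_add_right, ha, Int.floor_intCast_add, sub_add_cancel_right, abs_neg,
    Int.cast_abs]

theorem sepDist_omega_apply {i : ℕ} (hi : 1 ≤ i) (hin : i ≤ n) (x : V n) :
    sepDist x (omega n i x) = 2 * (i * (2 * n - i) : ℤ) := by
  have hi' : i ∈ Finset.Icc 1 n := Finset.mem_Icc.2 ⟨hi, hin⟩
  have habs : ∀ α ∈ posRoots n, |inner ℝ α (fundCoweight n i)| = inner ℝ α (fundCoweight n i) :=
    fun α hα => abs_of_nonneg ((mem_posRoots.1 hα).2 i hi')
  have h : (sepDist x (omega n i x) : ℝ) = 2 * (i * (2 * n - i)) := by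
    rw [omega, sepDist_trans_apply_right (fundCoweight_mem n i),
      sum_rootFinset_eq_two_mul_sum_posRoots fun α => by rw [inner_neg_left, abs_neg],
      Finset.sum_congr rfl habs, ← sum_inner, ← twoRho, real_inner_comm,
      inner_fundCoweight_twoRho hin]
  exact_mod_cast h

end SeparationDistance

section Alcove

variable {n : ℕ}

/-- The fundamental alcove: the points at which all simple affine roots are positive. -/
def alcove (n : ℕ) : Set (V n) := {x | ∀ j, 0 < affineSimpleRoot n j x}

theorem inner_simpleRoot_pos {x : V n} (hx : x ∈ alcove n) {j : ℕ} (hj : j ∈ Finset.Icc 1 n) :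
    0 < inner ℝ (simpleRoot n j) x := by
  rw [Finset.mem_Icc] at hj
  have h := hx ⟨j, by omega⟩
  rwa [affineSimpleRoot, if_neg (Fin.ne_of_val_ne (by simp; omega))] at h

theorem inner_theta_lt_one {x : V n} (hx : x ∈ alcove n) : inner ℝ (theta n) x < 1 := by
  have h := hx 0
  rwa [affineSimpleRoot, if_pos rfl, sub_pos] at h

theorem nonempty_alcove (hn : 2 ≤ n) : (alcove n).Nonempty := by
  have hn0 : (0 : ℝ) < 4 * n := by positivity
  refine ⟨(4 * n : ℝ)⁻¹ • twoRho n, fun j => ?_⟩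
  unfold affineSimpleRoot
  split_ifs with hj
  · rw [inner_smul_right, theta_eq_fundCoweight, inner_fundCoweight_twoRho hn, sub_pos,
      inv_mul_lt_one₀ hn0]
    push_cast
    linarith
  · have hj' : (j : ℕ) ∈ Finset.Icc 1 n := Finset.mem_Icc.2
      ⟨Nat.one_le_iff_ne_zero.2 (Fin.val_ne_zero_iff.2 hj), Nat.lt_succ_iff.1 j.is_lt⟩
    rw [inner_smul_right, inner_simpleRoot_twoRho hj', norm_sq_simpleRoot hj']
    split_ifs <;> positivity

theorem apply_mem_alcove {l : Aff n} (hl : l ∈ diagramGroup n) {x : V n} (hx : x ∈ alcove n) :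
    l x ∈ alcove n := by
  obtain ⟨-, σ, hσ⟩ := hl
  intro j
  rw [← σ.apply_symm_apply j, hσ]
  exact hx _

theorem IsPositive.inner_pos {α : V n} (hα : α ∈ roots n) (hpos : IsPositive α) {x : V n}
    (hx : x ∈ alcove n) : 0 < inner ℝ α x := by
  obtain ⟨k, hk, hαk⟩ : ∃ k ∈ Finset.Icc 1 n, 0 < inner ℝ α (fundCoweight n k) := by
    by_contra! h
    refine hpos.not_isPositive_neg hα fun k hk => ?_
    rw [inner_neg_left]
    linarith [h k hk]
  rw [inner_eq_sum_fundCoweight_mul_simpleRoot]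
  exact Finset.sum_pos' (fun k hk => mul_nonneg (hpos k hk) (inner_simpleRoot_pos hx hk).le)
    ⟨k, hk, mul_pos hαk (inner_simpleRoot_pos hx hk)⟩

theorem inner_lt_one_of_mem_alcove (hn : 2 ≤ n) {α : V n} (hα : α ∈ roots n) {x : V n}
    (hx : x ∈ alcove n) : inner ℝ α x < 1 := by
  refine lt_of_le_of_lt ?_ (inner_theta_lt_one hx)
  rw [inner_eq_sum_fundCoweight_mul_simpleRoot α,
    inner_eq_sum_fundCoweight_mul_simpleRoot (theta n)]
  exact Finset.sum_le_sum fun k hk => mul_le_mul_of_nonneg_right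
    (inner_fundCoweight_le_theta hn hα hk) (inner_simpleRoot_pos hx hk).le

open Classical in
theorem floor_inner_of_mem_alcove (hn : 2 ≤ n) {α : V n} (hα : α ∈ roots n) {x : V n}
    (hx : x ∈ alcove n) : ⌊(inner ℝ α x : ℝ)⌋ = if IsPositive α then 0 else -1 := by
  split_ifs with hpos
  · rw [Int.floor_eq_zero_iff]
    exact ⟨(hpos.inner_pos hα hx).le, inner_lt_one_of_mem_alcove hn hα hx⟩
  · have hneg := (isPositive_or_isPositive_neg hα).resolve_left hpos
    have h0 := hneg.inner_pos (neg_mem_roots hα) hx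
    have h1 := inner_lt_one_of_mem_alcove hn (neg_mem_roots hα) hx
    rw [inner_neg_left] at h0 h1
    rw [Int.floor_eq_iff]
    push_cast
    constructor <;> linarith

theorem sepDist_eq_zero_of_mem_alcove (hn : 2 ≤ n) {x y : V n} (hx : x ∈ alcove n)
    (hy : y ∈ alcove n) : sepDist x y = 0 := by
  refine Finset.sum_eq_zero fun α hα => ?_
  rw [mem_rootFinset] at hα
  rw [floor_inner_of_mem_alcove hn hα hx, floor_inner_of_mem_alcove hn hα hy, sub_self, abs_zero]

theorem isPositive_refl_simpleRoot_iff {α : V n} (hα : α ∈ roots n) {j : ℕ}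
    (hj : j ∈ Finset.Icc 1 n) (hαj : α ≠ simpleRoot n j) (hαj' : α ≠ -simpleRoot n j) :
    IsPositive (refl (simpleRoot n j) α) ↔ IsPositive α := by
  refine ⟨fun h => ?_, fun h => h.refl_simpleRoot hα hj hαj⟩
  rw [← refl_refl (simpleRoot n j) α]
  refine h.refl_simpleRoot (refl_mem_roots (simpleRoot_mem n j hj) hα) hj fun h' => hαj' ?_
  rw [← refl_refl (simpleRoot n j) α, h', refl_self]

theorem sepDist_refl_simpleRoot_le (hn : 2 ≤ n) {x : V n} (hx : x ∈ alcove n) {j : ℕ}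
    (hj : j ∈ Finset.Icc 1 n) : sepDist x (refl (simpleRoot n j) x) ≤ 2 := by
  classical
  have hαj_mem := simpleRoot_mem n j hj
  let S : Finset (V n) := {simpleRoot n j, -simpleRoot n j}
  have hterm : ∀ α ∈ rootFinset n,
      |⌊(inner ℝ α x : ℝ)⌋ - ⌊(inner ℝ α (refl (simpleRoot n j) x) : ℝ)⌋| ≤
        if α ∈ S then 1 else 0 := by
    intro α hα
    rw [mem_rootFinset] at hα
    rw [inner_refl_right, floor_inner_of_mem_alcove hn hα hx,
      floor_inner_of_mem_alcove hn (refl_mem_roots hαj_mem hα) hx]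
    by_cases hαS : α ∈ S
    · rw [if_pos hαS]
      split_ifs <;> norm_num
    · have hαS' := hαS
      rw [Finset.mem_insert, Finset.mem_singleton, not_or] at hαS'
      rw [if_neg hαS, if_congr (isPositive_refl_simpleRoot_iff hα hj hαS'.1 hαS'.2) rfl rfl,
        sub_self, abs_zero]
  calc sepDist x (refl (simpleRoot n j) x)
    _ ≤ ∑ α ∈ rootFinset n, if α ∈ S then 1 else 0 := Finset.sum_le_sum hterm
    _ = ((rootFinset n).filter (· ∈ S)).card := Finset.sum_boole _ _
    _ ≤ S.card := by
      exact_mod_cast Finset.card_le_card fun α hα => (Finset.mem_filter.1 hα).2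
    _ ≤ 2 := by exact_mod_cast Finset.card_le_two

end Alcove

section Generators

variable {n : ℕ}

theorem inner_e_s {j : ℕ} (hj : 1 ≤ j) (hjn : j < n) {m : ℕ} (hm : m ∈ Finset.Icc 1 n) (x : V n) :
    inner ℝ (e n m) (s n ⟨j, by omega⟩ x) = inner ℝ (e n (Equiv.swap j (j + 1) m)) x := by
  rw [s, if_neg (Fin.ne_of_val_ne (Nat.one_le_iff_ne_zero.1 hj)), refl_apply,
    norm_sq_simpleRoot (Finset.mem_Icc.2 ⟨hj, hjn.le⟩), if_neg hjn.ne,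
    mul_div_cancel_left₀ _ two_ne_zero, simpleRoot, if_neg hjn.ne, inner_sub_right,
    inner_smul_right, inner_sub_right, inner_e n m j hm, inner_e n m (j + 1) hm, inner_sub_left]
  rcases eq_or_ne m j with rfl | hmj
  · rw [Equiv.swap_apply_left, if_pos rfl, if_neg (by omega)]
    ring
  rcases eq_or_ne m (j + 1) with rfl | hmj'
  · rw [Equiv.swap_apply_right, if_neg (by omega), if_pos rfl]
    ring
  · rw [Equiv.swap_apply_of_ne_of_ne hmj hmj', if_neg hmj, if_neg hmj']
    ring

theorem inner_e_s_last {m : ℕ} (hm : m ∈ Finset.Icc 1 n) (x : V n) :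
    inner ℝ (e n m) (s n (Fin.last n) x) =
      if m = n then -inner ℝ (e n n) x else inner ℝ (e n m) x := by
  have hn : n ≠ 0 := by
    rw [Finset.mem_Icc] at hm
    omega
  have hn' : n ∈ Finset.Icc 1 n := Finset.mem_Icc.2 ⟨Nat.one_le_iff_ne_zero.2 hn, le_rfl⟩
  rw [s, if_neg (Fin.val_ne_zero_iff.1 hn), Fin.val_last, simpleRoot, if_pos rfl, refl_apply,
    norm_e n n hn', div_one, inner_sub_right, inner_smul_right, inner_e n m n hm]
  split_ifs with hmn
  · rw [hmn]
    ring
  · ring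

theorem inner_e_s_zero (hn : 2 ≤ n) {m : ℕ} (hm : m ∈ Finset.Icc 1 n) (x : V n) :
    inner ℝ (e n m) (s n 0 x) = if m = 1 then 1 - inner ℝ (e n 2) x
      else if m = 2 then 1 - inner ℝ (e n 1) x else inner ℝ (e n m) x := by
  rw [s, if_pos rfl, AffineEquiv.coe_mul, Function.comp_apply, trans_apply, refl_apply,
    norm_sq_theta hn, mul_div_cancel_left₀ _ two_ne_zero, inner_add_right, inner_sub_right,
    inner_smul_right, theta, inner_add_right, inner_e n m 1 hm, inner_e n m 2 hm, inner_add_left]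
  split_ifs with h1 h2 h2
  · omega
  · rw [h1]
    ring
  · rw [h2]
    ring
  · ring

theorem inner_e_piOne {m : ℕ} (hm : m ∈ Finset.Icc 1 n) (x : V n) :
    inner ℝ (e n m) (piOne n x) =
      if m = 1 then 1 - inner ℝ (e n 1) x else inner ℝ (e n m) x := by
  have h1 : 1 ∈ Finset.Icc 1 n := by
    rw [Finset.mem_Icc] at hm ⊢
    omega
  rw [piOne, AffineEquiv.coe_mul, Function.comp_apply, trans_apply, refl_apply, norm_e n 1 h1,
    div_one, inner_add_right, inner_sub_right, inner_smul_right, inner_e n m 1 hm]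
  split_ifs with hm1
  · rw [hm1]
    ring
  · ring

theorem inner_e_omega (i : ℕ) {m : ℕ} (hm : m ∈ Finset.Icc 1 n) (x : V n) :
    inner ℝ (e n m) (omega n i x) = (if m ≤ i then 1 else 0) + inner ℝ (e n m) x := by
  rw [omega, trans_apply, inner_add_right, inner_e_fundCoweight n i m hm]

theorem piOne_mul_s_one_mul_piOne (hn : 2 ≤ n) :
    piOne n * s n ⟨1, by omega⟩ * piOne n = s n 0 := by
  have h1 : 1 ∈ Finset.Icc 1 n := Finset.mem_Icc.2 (by omega)
  have h2 : 2 ∈ Finset.Icc 1 n := Finset.mem_Icc.2 (by omega)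
  refine AffineEquiv.ext fun x => eq_of_inner_e_eq fun m hm => ?_
  have hs {m : ℕ} (hm : m ∈ Finset.Icc 1 n) (y : V n) := inner_e_s le_rfl (show 1 < n by omega) hm y
  rw [AffineEquiv.coe_mul, AffineEquiv.coe_mul, Function.comp_apply, Function.comp_apply,
    inner_e_piOne hm, inner_e_s_zero hn hm]
  split_ifs with hm1 hm2
  · rw [hs h1, Equiv.swap_apply_left, inner_e_piOne h2, if_neg (by norm_num)]
  · rw [hm2, hs h2, Equiv.swap_apply_right, inner_e_piOne h1, if_pos rfl]
  · rw [hs hm, Equiv.swap_apply_of_ne_of_ne hm1 hm2, inner_e_piOne hm, if_neg hm1]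

end Generators

section Words

variable {n : ℕ}

theorem wordProd_cons (j : Fin (n + 1)) (L : List (Fin (n + 1))) :
    wordProd n (j :: L) = s n j * wordProd n L := by
  rw [wordProd, List.map_cons, List.prod_cons, wordProd]

theorem wordProd_append (L M : List (Fin (n + 1))) :
    wordProd n (L ++ M) = wordProd n L * wordProd n M := by
  rw [wordProd, List.map_append, List.prod_append, wordProd, wordProd]

theorem wordProd_flatten_replicate (L : List (Fin (n + 1))) (k : ℕ) :
    wordProd n (List.replicate k L).flatten = wordProd n L ^ k := by
  induction k with
  | zero => rfl
  | succ k ih => rw [List.replicate_succ, List.flatten_cons, wordProd_append, ih, pow_succ']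

theorem seg_cons {k l : ℕ} (hkl : k ≤ l) (hln : l ≤ n) :
    seg n k l = ⟨k, by omega⟩ :: seg n (k + 1) l := by
  have pairwise_seg (a b : ℕ) : (seg n a b).Pairwise (· < ·) :=
    (List.pairwise_lt_finRange (n + 1)).filter _
  have pairwise_cons : ((⟨k, by omega⟩ : Fin (n + 1)) :: seg n (k + 1) l).Pairwise (· < ·) := by
    refine List.pairwise_cons.2 ⟨fun j hj => ?_, pairwise_seg _ _⟩
    simp only [seg, List.mem_filter, decide_eq_true_eq] at hj
    exact Fin.lt_def.2 (Nat.lt_of_succ_le hj.2.1)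
  refine (pairwise_seg k l).eq_of_mem_iff pairwise_cons fun j => ?_
  simp only [seg, List.mem_filter, List.mem_finRange, true_and, decide_eq_true_eq, List.mem_cons,
    Fin.ext_iff]
  omega

theorem seg_eq_nil {k l : ℕ} (hlk : l < k) : seg n k l = [] := by
  refine List.filter_eq_nil_iff.2 fun j _ => ?_
  simp only [decide_eq_true_eq]
  omega

theorem length_seg (k : ℕ) {l : ℕ} (hln : l ≤ n) : (seg n k l).length = l + 1 - k := by
  rcases lt_or_ge l k with hlk | hkl
  · rw [seg_eq_nil hlk, List.length_nil, Nat.sub_eq_zero_of_le hlk]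
  · induction hkl using Nat.decreasingInduction with
    | self => rw [seg_cons le_rfl hln, seg_eq_nil (Nat.lt_succ_self l), List.length_singleton,
        Nat.add_sub_cancel_left]
    | of_succ k hkl ih =>
      rw [seg_cons hkl.le hln, List.length_cons, ih]
      omega

theorem swap_succ_mem_Icc {k m : ℕ} (hk : 1 ≤ k) (hkn : k < n) (hm : m ∈ Finset.Icc 1 n) :
    Equiv.swap k (k + 1) m ∈ Finset.Icc 1 n := by
  rw [Finset.mem_Icc] at hm ⊢
  rw [Equiv.swap_apply_def]
  split_ifs <;> omega

theorem inner_e_wordProd_seg {k l : ℕ} (hk : 1 ≤ k) (hkl : k ≤ l + 1) (hln : l < n) {m : ℕ}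
    (hm : m ∈ Finset.Icc 1 n) (x : V n) :
    inner ℝ (e n m) (wordProd n (seg n k l) x) =
      inner ℝ (e n (if m = k then l + 1 else if k < m ∧ m ≤ l + 1 then m - 1 else m)) x := by
  induction hkl using Nat.decreasingInduction generalizing m with
  | self =>
    rw [seg_eq_nil (Nat.lt_succ_self l)]
    change inner ℝ (e n m) x = _
    congr 2
    split_ifs <;> omega
  | of_succ k hkl ih =>
    rw [seg_cons (Nat.le_of_lt_succ hkl) hln.le, wordProd_cons, AffineEquiv.coe_mul,
      Function.comp_apply, inner_e_s hk (by omega) hm,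
      ih (by omega) (swap_succ_mem_Icc hk (by omega) hm)]
    congr 2
    rw [Equiv.swap_apply_def]
    split_ifs <;> omega

theorem inner_e_wordProd_seg_last {k : ℕ} (hk : 1 ≤ k) (hkn : k ≤ n) {m : ℕ}
    (hm : m ∈ Finset.Icc 1 n) (x : V n) :
    inner ℝ (e n m) (wordProd n (seg n k n) x) = if m = k then -inner ℝ (e n n) x
      else inner ℝ (e n (if k < m then m - 1 else m)) x := by
  induction hkn using Nat.decreasingInduction generalizing m with
  | self =>
    rw [seg_cons le_rfl le_rfl, seg_eq_nil (Nat.lt_succ_self n)]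
    change inner ℝ (e n m) (s n (Fin.last n) x) = _
    rw [inner_e_s_last hm, if_neg (Finset.mem_Icc.1 hm).2.not_gt]
  | of_succ k hkn ih =>
    have hswap : Equiv.swap k (k + 1) m = k + 1 ↔ m = k := by
      rw [Equiv.swap_apply_def]
      split_ifs <;> omega
    rw [seg_cons hkn.le le_rfl, wordProd_cons, AffineEquiv.coe_mul, Function.comp_apply,
      inner_e_s hk hkn hm, ih (by omega) (swap_succ_mem_Icc hk hkn hm)]
    by_cases hmk : m = k
    · rw [if_pos (hswap.2 hmk), if_pos hmk]
    · rw [if_neg (mt hswap.1 hmk), if_neg hmk, Equiv.swap_apply_def]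
      congr 2
      split_ifs <;> omega

end Words

section Translations

variable {n : ℕ}

/-- The affine map `x ↦ (1 + x_n, x_1, …, x_{n-1})`. -/
noncomputable def shift (n : ℕ) : Aff n := piOne n * wordProd n (seg n 1 n)

theorem inner_e_shift {m : ℕ} (hm : m ∈ Finset.Icc 1 n) (x : V n) :
    inner ℝ (e n m) (shift n x) =
      if m = 1 then 1 + inner ℝ (e n n) x else inner ℝ (e n (m - 1)) x := by
  obtain ⟨hm1, hmn⟩ := Finset.mem_Icc.1 hm
  have h1n : 1 ≤ n := hm1.trans hmn
  rw [shift, AffineEquiv.coe_mul, Function.comp_apply, inner_e_piOne hm,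
    inner_e_wordProd_seg_last le_rfl h1n hm,
    inner_e_wordProd_seg_last le_rfl h1n (Finset.mem_Icc.2 ⟨le_rfl, h1n⟩), if_pos rfl,
    sub_neg_eq_add]
  split_ifs with h h'
  · rfl
  · rfl
  · omega

theorem inner_e_shift_pow {i : ℕ} (hin : i ≤ n) {m : ℕ} (hm : m ∈ Finset.Icc 1 n) (x : V n) :
    inner ℝ (e n m) ((shift n ^ i) x) =
      if m ≤ i then 1 + inner ℝ (e n (n - i + m)) x else inner ℝ (e n (m - i)) x := by
  induction i generalizing m with
  | zero =>
    rw [if_neg (by rw [Finset.mem_Icc] at hm; omega)]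
    rfl
  | succ i ih =>
    obtain ⟨hm1, hmn⟩ := Finset.mem_Icc.1 hm
    rw [pow_succ', AffineEquiv.coe_mul, Function.comp_apply, inner_e_shift hm]
    split_ifs with h1 h2 h2
    · rw [ih (by omega) (Finset.mem_Icc.2 (by omega)), if_neg (by omega)]
      congr 3
      omega
    · omega
    · rw [ih (by omega) (Finset.mem_Icc.2 (by omega)), if_pos (by omega)]
      congr 3
      omega
    · rw [ih (by omega) (Finset.mem_Icc.2 (by omega)), if_neg (by omega)]
      congr 2
      omega

theorem s_zero_mul_wordProd_seg_mul_wordProd_seg (hn : 2 ≤ n) :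
    s n 0 * wordProd n (seg n 2 n) * wordProd n (seg n 1 n) = shift n ^ 2 := by
  refine AffineEquiv.ext fun x => eq_of_inner_e_eq fun m hm => ?_
  obtain ⟨hm1, hmn⟩ := Finset.mem_Icc.1 hm
  have h1 : 1 ∈ Finset.Icc 1 n := Finset.mem_Icc.2 (by omega)
  have h2 : 2 ∈ Finset.Icc 1 n := Finset.mem_Icc.2 (by omega)
  have hn' : n ∈ Finset.Icc 1 n := Finset.mem_Icc.2 (by omega)
  rw [AffineEquiv.coe_mul, AffineEquiv.coe_mul, Function.comp_apply, Function.comp_apply,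
    inner_e_s_zero hn hm, inner_e_shift_pow hn hm]
  split_ifs with hm1' hm2 hm2 hm2
  · rw [inner_e_wordProd_seg_last one_le_two hn h2, if_pos rfl,
      inner_e_wordProd_seg_last le_rfl (by omega) hn', if_neg (by omega), if_pos (by omega),
      sub_neg_eq_add]
    congr 3
    omega
  · omega
  · rw [inner_e_wordProd_seg_last one_le_two hn h1, if_neg (by omega), if_neg (by omega),
      inner_e_wordProd_seg_last le_rfl (by omega) h1, if_pos rfl, sub_neg_eq_add]
    congr 3
    omega
  · omega
  · omega
  · rw [inner_e_wordProd_seg_last one_le_two hn hm, if_neg hm2, if_pos (by omega),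
      inner_e_wordProd_seg_last le_rfl (by omega) (Finset.mem_Icc.2 (by omega)),
      if_neg (by omega), if_pos (by omega), Nat.sub_sub]

/-- The word `[r,r+i-1] [r-1,r+i-2] ⋯ [1,i]`. -/
def descendingSegs (n i : ℕ) : ℕ → List (Fin (n + 1))
  | 0 => []
  | r + 1 => seg n (r + 1) (r + i) ++ descendingSegs n i r

theorem tail_eq_descendingSegs {i : ℕ} (hin : i ≤ n) :
    tail n i = descendingSegs n i (n - i) := by
  have flatMap_seg (r : ℕ) : ((List.range r).flatMap fun t => seg n (r - t) (i + r - 1 - t)) =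
      descendingSegs n i r := by
    induction r with
    | zero => rfl
    | succ r ih =>
      rw [List.range_succ_eq_map, List.flatMap_cons, List.flatMap_map, descendingSegs, ← ih]
      congr 2
      · omega
      · funext t
        simp only [Nat.succ_eq_add_one]
        congr 1 <;> omega
  rw [tail, ← flatMap_seg, Nat.add_sub_cancel' hin]

theorem inner_e_wordProd_descendingSegs {i r : ℕ} (hr : i + r ≤ n) {m : ℕ}
    (hm : m ∈ Finset.Icc 1 n) (x : V n) :
    inner ℝ (e n m) (wordProd n (descendingSegs n i r) x) =
      inner ℝ (e n (if m ≤ r then i + m else if m ≤ i + r then m - r else m)) x := by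
  induction r generalizing m with
  | zero =>
    rw [Finset.mem_Icc] at hm
    rw [if_neg (by omega), Nat.sub_zero, ite_self]
    rfl
  | succ r ih =>
    have hm' := Finset.mem_Icc.1 hm
    rw [descendingSegs, wordProd_append, AffineEquiv.coe_mul, Function.comp_apply,
      inner_e_wordProd_seg (by omega) (by omega) (by omega) hm, ih (by omega)]
    · congr 2
      split_ifs <;> omega
    · rw [Finset.mem_Icc]
      split_ifs <;> omega

theorem length_descendingSegs {i r : ℕ} (hr : i + r ≤ n) :
    (descendingSegs n i r).length = r * i := by
  induction r with
  | zero => rw [descendingSegs, List.length_nil, zero_mul]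
  | succ r ih =>
    rw [descendingSegs, List.length_append, ih (by omega), length_seg _ (by omega), Nat.succ_mul]
    omega

theorem omega_eq_shift_pow_mul_wordProd_tail {i : ℕ} (hin : i ≤ n) :
    omega n i = shift n ^ i * wordProd n (tail n i) := by
  refine AffineEquiv.ext fun x => eq_of_inner_e_eq fun m hm => ?_
  obtain ⟨hm1, hmn⟩ := Finset.mem_Icc.1 hm
  rw [inner_e_omega i hm, AffineEquiv.coe_mul, Function.comp_apply, inner_e_shift_pow hin hm,
    tail_eq_descendingSegs hin]
  split_ifs with hmi
  · rw [inner_e_wordProd_descendingSegs (by omega) (Finset.mem_Icc.2 (by omega)),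
      if_neg (by omega), if_pos (by omega), Nat.add_sub_cancel_left]
  · rw [inner_e_wordProd_descendingSegs (by omega) (Finset.mem_Icc.2 (by omega)),
      if_pos (by omega), zero_add, Nat.add_sub_cancel' (by omega)]

end Translations

section ReducedExpressions

variable {n : ℕ}

theorem sepDist_s_apply_le (hn : 2 ≤ n) {x : V n} (hx : x ∈ alcove n) (j : Fin (n + 1)) :
    sepDist x (s n j x) ≤ 2 := by
  rcases eq_or_ne j 0 with rfl | hj
  · have hpi := piOne_mem n hn
    have hy : piOne n x ∈ alcove n := apply_mem_alcove hpi hx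
    rw [← piOne_mul_s_one_mul_piOne hn]
    calc sepDist x (piOne n (s n ⟨1, by omega⟩ (piOne n x)))
      _ ≤ sepDist x (piOne n (piOne n x)) +
          sepDist (piOne n (piOne n x)) (piOne n (s n ⟨1, by omega⟩ (piOne n x))) :=
        sepDist_triangle _ _ _
      _ = sepDist (piOne n x) (s n ⟨1, by omega⟩ (piOne n x)) := by
        rw [sepDist_eq_zero_of_mem_alcove hn hx (apply_mem_alcove hpi hy), zero_add,
          sepDist_apply_of_mem_extAffineWeyl hpi.1]
      _ ≤ 2 := sepDist_refl_simpleRoot_le (j := 1) hn hy (Finset.mem_Icc.2 (by omega))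
  · rw [s, if_neg hj]
    exact sepDist_refl_simpleRoot_le hn hx (Finset.mem_Icc.2
      ⟨Nat.one_le_iff_ne_zero.2 (Fin.val_ne_zero_iff.2 hj), Nat.lt_succ_iff.1 j.is_lt⟩)

theorem sepDist_wordProd_apply_le (hn : 2 ≤ n) {x : V n} (hx : x ∈ alcove n)
    (L : List (Fin (n + 1))) : sepDist x (wordProd n L x) ≤ 2 * L.length := by
  induction L with
  | nil => exact (sepDist_eq_zero_of_mem_alcove hn hx hx).le
  | cons j L ih =>
    rw [wordProd_cons, List.length_cons, Nat.cast_succ]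
    calc sepDist x (s n j (wordProd n L x))
      _ ≤ sepDist x (s n j x) + sepDist (s n j x) (s n j (wordProd n L x)) :=
        sepDist_triangle _ _ _
      _ = sepDist x (s n j x) + sepDist x (wordProd n L x) := by
        rw [sepDist_apply_of_mem_extAffineWeyl (s_mem n hn j)]
      _ ≤ 2 + 2 * L.length := add_le_add (sepDist_s_apply_le hn hx j) ih
      _ = 2 * (L.length + 1) := by ring

theorem sepDist_mul_wordProd_apply_le (hn : 2 ≤ n) {x : V n} (hx : x ∈ alcove n) {l : Aff n}
    (hl : l ∈ diagramGroup n) (L : List (Fin (n + 1))) :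
    sepDist x ((l * wordProd n L) x) ≤ 2 * L.length :=
  calc sepDist x (l (wordProd n L x))
    _ ≤ sepDist x (l x) + sepDist (l x) (l (wordProd n L x)) := sepDist_triangle _ _ _
    _ = sepDist x (wordProd n L x) := by
      rw [sepDist_eq_zero_of_mem_alcove hn hx (apply_mem_alcove hl hx), zero_add,
        sepDist_apply_of_mem_extAffineWeyl hl.1]
    _ ≤ 2 * L.length := sepDist_wordProd_apply_le hn hx L

theorem isReducedExpression_of_le_sepDist (hn : 2 ≤ n) {x : V n} (hx : x ∈ alcove n) {w l : Aff n}
    (hl : l ∈ diagramGroup n) {L : List (Fin (n + 1))} (hw : w = l * wordProd n L)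
    (hL : 2 * (L.length : ℤ) ≤ sepDist x (w x)) : IsReducedExpression n w l L := by
  refine ⟨hl, hw, le_antisymm (le_csInf ⟨_, l, hl, L, rfl, hw⟩ ?_)
    (Nat.sInf_le ⟨l, hl, L, rfl, hw⟩)⟩
  rintro _ ⟨l', hl', L', rfl, rfl⟩
  have := hL.trans (sepDist_mul_wordProd_apply_le hn hx hl' L')
  omega

theorem isReducedExpression_omega (hn : 2 ≤ n) {i : ℕ} (hi : 1 ≤ i) (hin : i ≤ n) {l : Aff n}
    (hl : l ∈ diagramGroup n) {L : List (Fin (n + 1))} (hw : omega n i = l * wordProd n L)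
    (hL : L.length = i * (2 * n - i)) : IsReducedExpression n (omega n i) l L := by
  obtain ⟨x, hx⟩ := nonempty_alcove hn
  refine isReducedExpression_of_le_sepDist hn hx hl hw ?_
  rw [sepDist_omega_apply hi hin, hL]
  push_cast [show i ≤ 2 * n by omega]
  rfl

end ReducedExpressions

section Expressions

variable {n i : ℕ}

theorem wordProd_block :
    wordProd n (block n) = s n 0 * wordProd n (seg n 2 n) * wordProd n (seg n 1 n) := by
  rw [block, wordProd_cons, wordProd_append, mul_assoc]

theorem length_block (hn : 1 ≤ n) : (block n).length = 2 * n := by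
  rw [block, List.length_cons, List.length_append, length_seg _ le_rfl, length_seg _ le_rfl]
  omega

theorem omega_eq_of_even (hn : 2 ≤ n) (hin : i ≤ n) (heven : Even i) :
    omega n i = (s n 0 * wordProd n (seg n 2 n) * wordProd n (seg n 1 n)) ^ (i / 2) *
      wordProd n (tail n i) := by
  rw [s_zero_mul_wordProd_seg_mul_wordProd_seg hn, ← pow_mul, Nat.two_mul_div_two_of_even heven,
    omega_eq_shift_pow_mul_wordProd_tail hin]

theorem omega_eq_of_odd (hn : 2 ≤ n) (hin : i ≤ n) (hodd : Odd i) :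
    omega n i = piOne n * wordProd n (seg n 1 n) *
      (s n 0 * wordProd n (seg n 2 n) * wordProd n (seg n 1 n)) ^ ((i - 1) / 2) *
        wordProd n (tail n i) := by
  rw [s_zero_mul_wordProd_seg_mul_wordProd_seg hn, ← pow_mul, ← shift, ← pow_succ',
    Nat.two_mul_div_two_of_even (Nat.Odd.sub_odd hodd odd_one),
    Nat.sub_add_cancel (show 1 ≤ i from hodd.pos), omega_eq_shift_pow_mul_wordProd_tail hin]

theorem wordProd_evenWord :
    wordProd n (evenWord n i) =
      (s n 0 * wordProd n (seg n 2 n) * wordProd n (seg n 1 n)) ^ (i / 2) *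
        wordProd n (tail n i) := by
  rw [evenWord, wordProd_append, wordProd_flatten_replicate, wordProd_block]

theorem wordProd_oddWord :
    wordProd n (oddWord n i) = wordProd n (seg n 1 n) *
      (s n 0 * wordProd n (seg n 2 n) * wordProd n (seg n 1 n)) ^ ((i - 1) / 2) *
        wordProd n (tail n i) := by
  rw [oddWord, wordProd_append, wordProd_append, wordProd_flatten_replicate, wordProd_block]

theorem length_flatten_replicate_block (hn : 1 ≤ n) (k : ℕ) :
    (List.replicate k (block n)).flatten.length = k * (2 * n) := by
  rw [List.length_flatten, List.map_replicate, List.sum_replicate, length_block hn, smul_eq_mul]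

theorem length_tail (hin : i ≤ n) : (tail n i).length = (n - i) * i := by
  rw [tail_eq_descendingSegs hin, length_descendingSegs (Nat.add_sub_cancel' hin).le]

theorem length_evenWord (hn : 1 ≤ n) (hin : i ≤ n) (heven : Even i) :
    (evenWord n i).length = i * (2 * n - i) := by
  obtain ⟨d, rfl⟩ := Nat.exists_eq_add_of_le hin
  rw [evenWord, List.length_append, length_flatten_replicate_block hn, length_tail hin,
    ← mul_assoc, mul_comm (i / 2), Nat.two_mul_div_two_of_even heven, Nat.add_sub_cancel_left,
    show 2 * (i + d) - i = i + 2 * d by omega]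
  ring

theorem length_oddWord (hin : i ≤ n) (hodd : Odd i) :
    (oddWord n i).length = i * (2 * n - i) := by
  obtain ⟨d, rfl⟩ := Nat.exists_eq_add_of_le hin
  obtain ⟨k, rfl⟩ := hodd
  rw [oddWord, List.length_append, List.length_append, length_seg _ le_rfl,
    length_flatten_replicate_block (by omega), length_tail hin, Nat.add_sub_cancel,
    Nat.add_sub_cancel, Nat.mul_div_cancel_left k two_pos, Nat.add_sub_cancel_left,
    show 2 * (2 * k + 1 + d) - (2 * k + 1) = 2 * k + 1 + 2 * d by omega]
  ring

theorem isReducedExpression_omega_of_even (hn : 2 ≤ n) (hi : 1 ≤ i) (hin : i ≤ n)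
    (heven : Even i) : IsReducedExpression n (omega n i) 1 (evenWord n i) := by
  refine isReducedExpression_omega hn hi hin (one_mem _) ?_
    (length_evenWord (hi.trans hin) hin heven)
  rw [one_mul, wordProd_evenWord, ← omega_eq_of_even hn hin heven]

theorem isReducedExpression_omega_of_odd (hn : 2 ≤ n) (hin : i ≤ n) (hodd : Odd i) :
    IsReducedExpression n (omega n i) (piOne n) (oddWord n i) := by
  refine isReducedExpression_omega hn hodd.pos hin (piOne_mem n hn) ?_ (length_oddWord hin hodd)
  rw [wordProd_oddWord, ← mul_assoc, ← mul_assoc, ← omega_eq_of_odd hn hin hodd]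

end Expressions

end AffineB

theorem mainTheorem6 (n i : ℕ) (hn : 2 ≤ n) (hi : 1 ≤ i) (hin : i ≤ n) :
    (Odd i →
      AffineB.omega n i =
        AffineB.piOne n * AffineB.wordProd n (AffineB.seg n 1 n) *
          (AffineB.s n 0 * AffineB.wordProd n (AffineB.seg n 2 n) *
            AffineB.wordProd n (AffineB.seg n 1 n)) ^ ((i - 1) / 2) *
          AffineB.wordProd n (AffineB.tail n i) ∧
      AffineB.IsReducedExpression n (AffineB.omega n i) (AffineB.piOne n) (AffineB.oddWord n i) ∧
      (AffineB.oddWord n i).length = i * (2 * n - i)) ∧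
    (Even i →
      AffineB.omega n i =
        (AffineB.s n 0 * AffineB.wordProd n (AffineB.seg n 2 n) *
            AffineB.wordProd n (AffineB.seg n 1 n)) ^ (i / 2) *
          AffineB.wordProd n (AffineB.tail n i) ∧
      AffineB.IsReducedExpression n (AffineB.omega n i) 1 (AffineB.evenWord n i) ∧
      (AffineB.evenWord n i).length = i * (2 * n - i)) ∧
    AffineB.length n (AffineB.omega n i) = i * (2 * n - i) := by
  refine ⟨fun hodd => ⟨AffineB.omega_eq_of_odd hn hin hodd,
      AffineB.isReducedExpression_omega_of_odd hn hin hodd, AffineB.length_oddWord hin hodd⟩,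
    fun heven => ⟨AffineB.omega_eq_of_even hn hin heven,
      AffineB.isReducedExpression_omega_of_even hn hi hin heven,
      AffineB.length_evenWord (hi.trans hin) hin heven⟩, ?_⟩
  rcases Nat.even_or_odd i with heven | hodd
  · obtain ⟨-, -, hlength⟩ := AffineB.isReducedExpression_omega_of_even hn hi hin heven
    rw [← hlength, AffineB.length_evenWord (hi.trans hin) hin heven]
  · obtain ⟨-, -, hlength⟩ := AffineB.isReducedExpression_omega_of_odd hn hin hodd
    rw [← hlength, AffineB.length_oddWord hin hodd]
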